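/- Let $X$ be a real Banach space with closed unit ball $B_X$ that contains a copy of $c_0$, i.e. has a linear subspace isomorphic to $c_0$ (the space of real null sequences with the sup norm). For $C\subseteq X$ let $\mathcal B(C)$ be the family of nonempty bounded closed convex subsets of $C$. For a map $T\colon K\to K$, $K\subseteq X$, let $\mathrm{Fix}(T)$ be its set of fixed points and $\mathrm d(T,K)=\inf_{x\in K}\|x-Tx\|$. For $\alpha,\lambda\in(0,1)$, $T$ is called $\alpha$-Hölder nonexpansive if $\|Tx-Ty\|\le\|x-y\|^\alpha$ for all $x,y\in K$, and uniformly $\alpha$-Hölder $\lambda$-contractive if $\|T^nx-T^ny\|\le\lambda\|x-y\|^\alpha$ for all $x,y\in K$ and all integers $n\ge1$. Then: (1) There exist $K\in\mathcal B(B_X)$ and a family $(T_\alpha)_{\alpha\in(0,1)}$ of maps $T_\alpha\colon K\to K$ such that, for every $\alpha\in(0,1)$, $T_\alpha$ is $\alpha$-Hölder nonexpansive, $\mathrm{Fix}(T_\alpha)=\emptyset$, and $$\mathrm d(T_\alpha,K)\le(1-\alpha)\sup_{0<t<1}t^\alpha|\ln t| ;$$ moreover the limit $T(x)=\lim_{\alpha\to1^-}T_\alpha(x)$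 exists for every $x\in K$ and defines a nonexpansive map $T\colon K\to K$ (that is, $\|Tx-Ty\|\le\|x-y\|$ for all $x,y\in K$), and either $\mathrm{Fix}(T)=\emptyset$ or $\mathrm{Fix}(T)$ consists of exactly one point. (2) For all $\alpha,\lambda\in(0,1)$ there exist $K\in\mathcal B(X)$ and a uniformly $\alpha$-Hölder $\lambda$-contractive map $F\colon K\to K$ without fixed points such that $\mathrm d(F,K)=0$. (3) If $X$ is separably Sobczyk, i.e. every subspace of $X$ isomorphic to $c_0$ is complemented in $X$, then for all $\alpha,\lambda\in(0,1)$ there exists a uniformly $\alpha$-Hölder $\lambda$-contractive map $T\colon B_X\to B_X$ without fixed points such that $\mathrm d(T,B_X)=0$. -/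

import Mathlib

open Set Filter Topology
open scoped ZeroAtInfty

/-- `Y` is a linear subspace of `X` isomorphic (as a topological vector space) to `c₀`, the Banach
space of real null sequences with the sup norm; `C₀(ℕ, ℝ)` is Mathlib's version of `c₀`.
Such a subspace is automatically closed. -/
def IsCopyOfC0 {X : Type*} [NormedAddCommGroup X] [NormedSpace ℝ X] (Y : Submodule ℝ X) : Prop :=
  Nonempty (Y ≃L[ℝ] C₀(ℕ, ℝ))

/-- `X` contains an isomorphic copy of `c₀`. -/
def ContainsCopyOfC0 (X : Type*) [NormedAddCommGroup X] [NormedSpace ℝ X] : Prop :=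
  ∃ Y : Submodule ℝ X, IsCopyOfC0 Y

/-- `X` is separably Sobczyk: every subspace of `X` isomorphic to `c₀` is complemented, i.e. is
the range of a bounded linear projection. -/
def SeparablySobczyk (X : Type*) [NormedAddCommGroup X] [NormedSpace ℝ X] : Prop :=
  ∀ Y : Submodule ℝ X, IsCopyOfC0 Y → Y.ClosedComplemented

/-- The family `𝓑(C)` of all nonempty bounded closed convex subsets of `C`. -/
def boundedClosedConvexSubsets {X : Type*} [NormedAddCommGroup X] [NormedSpace ℝ X]
    (C : Set X) : Set (Set X) :=
  {K | K ⊆ C ∧ K.Nonempty ∧ Bornology.IsBounded K ∧ IsClosed K ∧ Convex ℝ K}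

/-- `T` is `α`-Hölder nonexpansive. -/
def HolderNonexpansive {M : Type*} [MetricSpace M] (α : ℝ) (T : M → M) : Prop :=
  ∀ x y : M, dist (T x) (T y) ≤ dist x y ^ α

/-- `T` is uniformly `α`-Hölder `lam`-contractive (for `0 < lam < 1`): every iterate `T^n`,
`n ≥ 1`, satisfies the `α`-Hölder condition with the same constant `lam`. -/
def UniformlyHolderContractive {M : Type*} [MetricSpace M] (α lam : ℝ) (T : M → M) : Prop :=
  ∀ n : ℕ, 1 ≤ n → ∀ x y : M, dist (T^[n] x) (T^[n] y) ≤ lam * dist x y ^ α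

/-- The minimal displacement `d(T, K) = inf {‖x - T x‖ : x ∈ K}`. -/
noncomputable def minimalDisplacement {X : Type*} [NormedAddCommGroup X] {K : Set X}
    (T : K → K) : ℝ :=
  ⨅ x : K, ‖(x : X) - (T x : X)‖

/-! Everything rests on one map of `c₀`: truncate all coordinates to `[0, δ]`, shift right, and put
`δ` in front. It is nonexpansive; a fixed point would be the constant sequence `δ`, which is not
null; slowly decreasing ramps are almost fixed. All its values lie in a box of diameter at most `δ`,
so interpolating between this bound and nonexpansiveness gives every iterate the Hölder constant `δ
^ (1 - α)`, as small as desired (`dist_iterate_truncShift_le_rpow`).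
`exists_uniformlyHolderContractive` conjugates this map into `X`. The Lipschitz left inverse it
needs is the inverse isomorphism on the image of a box, and a projection followed by that
isomorphism on the unit ball. For the family indexed by `α`, the identity is averaged with such maps
of norm at most `1 - α`: averaging keeps the fixed points, and the limit is `x / 2`. -/

/-- The order interval `[0, r]` of `c₀`. -/
def c0Box (r : ℝ) : Set C₀(ℕ, ℝ) := {x | ∀ n, x n ∈ Icc 0 r}

/-! ### The truncated shift on `c₀`. -/

namespace C0Shift

lemma tendsto_zero (x : C₀(ℕ, ℝ)) : Tendsto x atTop (𝓝 0) := by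
  have h := x.zero_at_infty'
  rwa [cocompact_eq_cofinite, Nat.cofinite_eq_atTop] at h

/-- A null sequence as an element of `c₀`. -/
def ofNull (u : ℕ → ℝ) (hu : Tendsto u atTop (𝓝 0)) : C₀(ℕ, ℝ) where
  toFun := u
  continuous_toFun := continuous_of_discreteTopology
  zero_at_infty' := by rwa [cocompact_eq_cofinite, Nat.cofinite_eq_atTop]

@[simp] lemma ofNull_apply (u : ℕ → ℝ) (hu : Tendsto u atTop (𝓝 0)) (n : ℕ) :
    ofNull u hu n = u n := rfl

lemma dist_le_iff {x y : C₀(ℕ, ℝ)} {C : ℝ} (hC : 0 ≤ C) :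
    dist x y ≤ C ↔ ∀ n, |x n - y n| ≤ C := by
  rw [← ZeroAtInftyContinuousMap.dist_toBCF_eq_dist, BoundedContinuousFunction.dist_le hC]
  rfl

lemma abs_sub_le_dist (x y : C₀(ℕ, ℝ)) (n : ℕ) : |x n - y n| ≤ dist x y :=
  (dist_le_iff dist_nonneg).1 le_rfl n

/-- The sequence obtained from `x` by truncating its terms to `[0, δ]` and prepending `δ`. -/
def truncShiftSeq (δ : ℝ) (x : ℕ → ℝ) : ℕ → ℝ
  | 0 => δ
  | n + 1 => max 0 (min (x n) δ)

/-- Truncation to `[0, δ]` followed by the right shift with first coordinate `δ`. -/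
def truncShift {δ : ℝ} (hδ : 0 ≤ δ) (x : C₀(ℕ, ℝ)) : C₀(ℕ, ℝ) :=
  ofNull (truncShiftSeq δ x) <| by
    rw [← tendsto_add_atTop_iff_nat 1]
    have h : Tendsto (fun n => max 0 (min (x n) δ)) atTop (𝓝 (max 0 (min 0 δ))) :=
      tendsto_const_nhds.max ((tendsto_zero x).min tendsto_const_nhds)
    simpa [hδ, truncShiftSeq] using h

variable {δ : ℝ} (hδ : 0 ≤ δ)

@[simp] lemma truncShift_zero (x : C₀(ℕ, ℝ)) : truncShift hδ x 0 = δ := rfl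

@[simp] lemma truncShift_succ (x : C₀(ℕ, ℝ)) (n : ℕ) :
    truncShift hδ x (n + 1) = max 0 (min (x n) δ) := rfl

lemma truncShift_mem_c0Box (x : C₀(ℕ, ℝ)) : truncShift hδ x ∈ c0Box δ := by
  rintro (_ | n)
  · exact ⟨hδ, le_rfl⟩
  · exact ⟨le_max_left _ _, max_le hδ (min_le_right _ _)⟩

lemma dist_truncShift_le (x y : C₀(ℕ, ℝ)) :
    dist (truncShift hδ x) (truncShift hδ y) ≤ dist x y := by
  refine (dist_le_iff dist_nonneg).2 ?_
  rintro (_ | n)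
  · simp
  · calc |truncShift hδ x (n + 1) - truncShift hδ y (n + 1)|
        ≤ |min (x n) δ - min (y n) δ| := by
          simpa using abs_max_sub_max_le_max 0 (min (x n) δ) 0 (min (y n) δ)
      _ ≤ |x n - y n| := by simpa using abs_min_sub_min_le_max (x n) δ (y n) δ
      _ ≤ dist x y := abs_sub_le_dist x y n

lemma dist_le_of_mem_c0Box {r : ℝ} (hr : 0 ≤ r) {x y : C₀(ℕ, ℝ)} (hx : x ∈ c0Box r)
    (hy : y ∈ c0Box r) : dist x y ≤ r :=
  (dist_le_iff hr).2 fun n => abs_sub_le_iff.2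
    ⟨by linarith [(hx n).2, (hy n).1], by linarith [(hy n).2, (hx n).1]⟩

lemma c0Box_mono {r s : ℝ} (h : r ≤ s) : c0Box r ⊆ c0Box s :=
  fun _ hx n => ⟨(hx n).1, (hx n).2.trans h⟩

lemma zero_mem_c0Box {r : ℝ} (hr : 0 ≤ r) : (0 : C₀(ℕ, ℝ)) ∈ c0Box r :=
  fun _ => ⟨le_rfl, hr⟩

lemma norm_le_of_mem_c0Box {r : ℝ} (hr : 0 ≤ r) {x : C₀(ℕ, ℝ)} (hx : x ∈ c0Box r) : ‖x‖ ≤ r := by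
  simpa using dist_le_of_mem_c0Box hr hx (zero_mem_c0Box hr)

lemma convex_c0Box (r : ℝ) : Convex ℝ (c0Box r) :=
  fun _ hx _ hy _ _ ha hb hab n => convex_Icc 0 r (hx n) (hy n) ha hb hab

lemma isClosed_c0Box (r : ℝ) : IsClosed (c0Box r) := by
  have : c0Box r = ⋂ n, (fun x : C₀(ℕ, ℝ) => x n) ⁻¹' Icc 0 r := by
    ext; simp [c0Box]
  rw [this]
  refine isClosed_iInter fun n => isClosed_Icc.preimage ?_
  exact (LipschitzWith.of_dist_le_mul (K := 1) fun x y => by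
    simpa [Real.dist_eq] using abs_sub_le_dist x y n).continuous

lemma dist_iterate_truncShift_le (n : ℕ) (x y : C₀(ℕ, ℝ)) :
    dist ((truncShift hδ)^[n] x) ((truncShift hδ)^[n] y) ≤ dist x y := by
  induction n with
  | zero => rfl
  | succ n ih =>
    rw [Function.iterate_succ_apply', Function.iterate_succ_apply']
    exact (dist_truncShift_le hδ _ _).trans ih

lemma iterate_truncShift_mem_c0Box {n : ℕ} (hn : 1 ≤ n) (x : C₀(ℕ, ℝ)) :
    (truncShift hδ)^[n] x ∈ c0Box δ := by
  obtain ⟨n, rfl⟩ := Nat.exists_eq_add_of_le' hn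
  rw [Function.iterate_succ_apply']
  exact truncShift_mem_c0Box hδ _

/-- Split `d = d ^ (1 - α) * d ^ α`: the first factor is controlled by the diameter of the range,
the second by nonexpansiveness. -/
lemma dist_iterate_truncShift_le_rpow {α : ℝ} (hα : α ∈ Ioo (0 : ℝ) 1) {n : ℕ} (hn : 1 ≤ n)
    (x y : C₀(ℕ, ℝ)) :
    dist ((truncShift hδ)^[n] x) ((truncShift hδ)^[n] y) ≤ δ ^ (1 - α) * dist x y ^ α := by
  set d := dist ((truncShift hδ)^[n] x) ((truncShift hδ)^[n] y)
  have hd : 0 ≤ d := dist_nonneg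
  calc d = d ^ (1 - α) * d ^ α := by
        rw [← Real.rpow_add_of_nonneg hd (by linarith [hα.2]) hα.1.le]; simp
    _ ≤ δ ^ (1 - α) * dist x y ^ α := by
        have h1 : d ≤ δ := dist_le_of_mem_c0Box hδ (iterate_truncShift_mem_c0Box hδ hn x)
          (iterate_truncShift_mem_c0Box hδ hn y)
        have h2 : d ≤ dist x y := dist_iterate_truncShift_le hδ n x y
        have h3 := hα.1.le
        have h4 : 0 ≤ 1 - α := by linarith [hα.2]
        gcongr

lemma truncShift_ne_self (hδ : 0 < δ) (x : C₀(ℕ, ℝ)) : truncShift hδ.le x ≠ x := by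
  intro h
  have hx : ∀ n, x n = δ := by
    intro n
    induction n with
    | zero => rw [← h, truncShift_zero]
    | succ n ih => rw [← h, truncShift_succ, ih, min_self, max_eq_right hδ.le]
  have h0 := (tendsto_zero x).congr hx
  exact hδ.ne (tendsto_nhds_unique h0 tendsto_const_nhds)

lemma exists_dist_truncShift_lt (hδ : 0 < δ) {ε : ℝ} (hε : 0 < ε) :
    ∃ x ∈ c0Box δ, dist x (truncShift hδ.le x) < ε := by
  obtain ⟨N, hN⟩ := exists_nat_gt (δ / ε)
  have hN0 : (0 : ℝ) < N := (div_pos hδ hε).trans hN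
  -- A ramp from `δ` down to `0` in `N` equal steps; natural subtraction keeps it at `0` afterwards.
  -- It lies in the box, so truncation does nothing and the shift moves each coordinate by at most
  -- `δ / N`.
  set u : ℕ → ℝ := fun n => δ / N * ((N - n : ℕ) : ℝ) with hu
  have hu0 : Tendsto u atTop (𝓝 0) := by
    refine tendsto_const_nhds.congr' ?_
    filter_upwards [eventually_ge_atTop N] with n hn
    simp [hu, Nat.sub_eq_zero_of_le hn]
  have hbox : ofNull u hu0 ∈ c0Box δ := by
    intro n
    refine ⟨by simp only [ofNull_apply, hu]; positivity, ?_⟩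
    calc u n ≤ δ / N * N := by
          simp only [hu]; gcongr; exact Nat.sub_le _ _
      _ = δ := by field_simp
  refine ⟨ofNull u hu0, hbox, lt_of_le_of_lt ((dist_le_iff (C := δ / N) (by positivity)).2 ?_) ?_⟩
  · rintro (_ | n)
    · have : u 0 = δ := by simp only [hu, Nat.sub_zero]; field_simp
      simp only [ofNull_apply, truncShift_zero, this, sub_self, abs_zero]; positivity
    · have hb := hbox n
      rw [truncShift_succ, min_eq_left hb.2, max_eq_right hb.1]
      simp only [ofNull_apply, hu, ← mul_sub, abs_mul, abs_of_pos (div_pos hδ hN0)]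
      refine mul_le_of_le_one_right (by positivity) ?_
      rcases le_or_gt N n with h | h
      · simp [Nat.sub_eq_zero_of_le h, Nat.sub_eq_zero_of_le (h.trans n.le_succ)]
      · rw [Nat.cast_sub h.le, Nat.cast_sub h]; push_cast
        rw [show (N : ℝ) - (n + 1) - (N - n) = -1 by ring]; simp
  · rw [div_lt_iff₀ hN0, mul_comm]; rwa [div_lt_iff₀ hε] at hN

end C0Shift

/-! ### Transfer of the shift to subsets of a normed space. -/

open C0Shift

lemma minimalDisplacement_eq_zero {X : Type*} [NormedAddCommGroup X] [NormedSpace ℝ X] {K : Set X}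
    {T : K → K} (h : ∀ ε > 0, ∃ x : K, ‖(x : X) - T x‖ < ε) : minimalDisplacement T = 0 := by
  have hb : BddBelow (range fun x : K => ‖(x : X) - T x‖) :=
    ⟨0, by rintro _ ⟨x, rfl⟩; exact norm_nonneg _⟩
  refine le_antisymm (le_of_forall_pos_lt_add fun ε hε => ?_)
    (Real.iInf_nonneg fun _ => norm_nonneg _)
  obtain ⟨x, hx⟩ := h ε hε
  rw [zero_add]
  exact (ciInf_le hb x).trans_lt hx

/-- If `J : c₀ → X` has a Lipschitz left inverse on `A`, and `A` contains the image of an order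
interval, then `A` has fixed point free uniformly Hölder contractive self-maps with approximate
fixed points and with arbitrarily small values. -/
lemma exists_uniformlyHolderContractive {X : Type*} [NormedAddCommGroup X] [NormedSpace ℝ X]
    (J : C₀(ℕ, ℝ) →L[ℝ] X) {A : Set X} {D : A → C₀(ℕ, ℝ)} {L : NNReal} (hD : LipschitzWith L D)
    (hDJ : ∀ x (h : J x ∈ A), D ⟨J x, h⟩ = x) {r : ℝ} (hr : 0 < r) (hA : ∀ x ∈ c0Box r, J x ∈ A)
    {α lam η : ℝ} (hα : α ∈ Ioo (0 : ℝ) 1) (hlam : 0 < lam) (hη : 0 < η) :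
    ∃ T : A → A, Function.fixedPoints T = ∅ ∧ UniformlyHolderContractive α lam T ∧
      (∀ ε > 0, ∃ x : A, ‖(x : X) - T x‖ < ε) ∧ ∀ x, ‖(T x : X)‖ ≤ η := by
  have hα' : 0 < 1 - α := by linarith [hα.2]
  -- All the bounds hold for small `δ > 0`; the last one because `1 - α > 0`.
  obtain ⟨δ, hδ, hδr, hδη, hδlam⟩ : ∃ δ > 0, δ ≤ r ∧ ‖J‖ * δ ≤ η ∧
      ‖J‖ * (δ ^ (1 - α) * (L : ℝ) ^ α) ≤ lam := by
    have h1 : Tendsto (fun δ : ℝ => ‖J‖ * δ) (𝓝 0) (𝓝 0) := by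
      simpa using (continuous_const_mul ‖J‖).tendsto (0 : ℝ)
    have h2 : Tendsto (fun δ : ℝ => ‖J‖ * (δ ^ (1 - α) * (L : ℝ) ^ α)) (𝓝 0) (𝓝 0) := by
      have h := (Real.continuousAt_rpow_const 0 (1 - α) (Or.inr hα'.le)).tendsto
      rw [Real.zero_rpow hα'.ne'] at h
      simpa using (h.mul_const ((L : ℝ) ^ α)).const_mul ‖J‖
    have h := ((eventually_le_nhds hr).and ((h1.eventually_le_const hη).and
      (h2.eventually_le_const hlam))).filter_mono (nhdsWithin_le_nhds (s := Ioi 0))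
    obtain ⟨δ, h, hδ⟩ := (h.and self_mem_nhdsWithin).exists
    exact ⟨δ, hδ, h.1, h.2.1, h.2.2⟩
  have hmem (x : C₀(ℕ, ℝ)) : J (truncShift hδ.le x) ∈ A :=
    hA _ (c0Box_mono hδr (truncShift_mem_c0Box hδ.le x))
  let T : A → A := fun x => ⟨J (truncShift hδ.le (D x)), hmem _⟩
  -- Iterates of `T` thus reduce to iterates of the shift, so `J` and `D` cost the factor `‖J‖ * L ^
  -- α` only once, whatever `n` is.
  have hDT : Function.Semiconj D T (truncShift hδ.le) := fun x => hDJ _ _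
  have hTn : ∀ n, 1 ≤ n → ∀ x, (T^[n] x : X) = J ((truncShift hδ.le)^[n] (D x)) := by
    intro n hn x
    obtain ⟨n, rfl⟩ := Nat.exists_eq_add_of_le' hn
    rw [Function.iterate_succ_apply', Function.iterate_succ_apply', ← (hDT.iterate_right n) x]
  refine ⟨T, ?_, ?_, ?_, ?_⟩
  · refine eq_empty_of_forall_notMem fun x hx => truncShift_ne_self hδ (D x) ?_
    rw [← hDT x, hx]
  · intro n hn x y
    rw [Subtype.dist_eq, hTn n hn, hTn n hn]
    calc dist (J ((truncShift hδ.le)^[n] (D x))) (J ((truncShift hδ.le)^[n] (D y)))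
        ≤ ‖J‖ * dist ((truncShift hδ.le)^[n] (D x)) ((truncShift hδ.le)^[n] (D y)) :=
          J.lipschitz.dist_le_mul _ _
      _ ≤ ‖J‖ * (δ ^ (1 - α) * dist (D x) (D y) ^ α) := by
          gcongr; exact dist_iterate_truncShift_le_rpow hδ.le hα hn _ _
      _ ≤ ‖J‖ * (δ ^ (1 - α) * (L * dist x y) ^ α) := by
          have := hα.1.le
          gcongr; exact hD.dist_le_mul _ _
      _ = ‖J‖ * (δ ^ (1 - α) * (L : ℝ) ^ α) * dist x y ^ α := by
          rw [Real.mul_rpow L.coe_nonneg dist_nonneg]; ring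
      _ ≤ lam * dist x y ^ α := by gcongr
  · intro ε hε
    obtain ⟨x, hx, hxd⟩ := exists_dist_truncShift_lt hδ
      (ε := ε / (‖J‖ + 1)) (by positivity)
    refine ⟨⟨J x, hA x (c0Box_mono hδr hx)⟩, ?_⟩
    change ‖J x - J (truncShift hδ.le (D ⟨J x, _⟩))‖ < ε
    rw [hDJ, ← dist_eq_norm]
    rw [lt_div_iff₀ (by positivity)] at hxd
    calc dist (J x) (J (truncShift hδ.le x)) ≤ ‖J‖ * dist x (truncShift hδ.le x) :=
          J.lipschitz.dist_le_mul _ _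
      _ ≤ dist x (truncShift hδ.le x) * (‖J‖ + 1) := by
          rw [mul_comm]; gcongr; linarith
      _ < ε := hxd
  · intro x
    calc ‖J (truncShift hδ.le (D x))‖ ≤ ‖J‖ * ‖truncShift hδ.le (D x)‖ := J.le_opNorm _
      _ ≤ ‖J‖ * δ := by
          gcongr; exact norm_le_of_mem_c0Box hδ.le (truncShift_mem_c0Box hδ.le _)
      _ ≤ η := hδη

/-- The embedding of `c₀` in `X` given by a copy of `c₀`. -/
noncomputable def c0Embedding {X : Type*} [NormedAddCommGroup X] [NormedSpace ℝ X]
    {Y : Submodule ℝ X} (e : Y ≃L[ℝ] C₀(ℕ, ℝ)) : C₀(ℕ, ℝ) →L[ℝ] X :=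
  Y.subtypeL ∘L (e.symm : C₀(ℕ, ℝ) →L[ℝ] Y)

/-! ### Maps on images of boxes and on the unit ball. -/

section Embedding

variable {X : Type*} [NormedAddCommGroup X] [NormedSpace ℝ X] {Y : Submodule ℝ X}

lemma c0Embedding_mem (e : Y ≃L[ℝ] C₀(ℕ, ℝ)) (x : C₀(ℕ, ℝ)) : c0Embedding e x ∈ Y := (e.symm x).2

lemma c0Embedding_symm (e : Y ≃L[ℝ] C₀(ℕ, ℝ)) (x : C₀(ℕ, ℝ)) (h : c0Embedding e x ∈ Y) :
    e ⟨c0Embedding e x, h⟩ = x := e.apply_symm_apply x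

lemma isClosed_c0Embedding_image (e : Y ≃L[ℝ] C₀(ℕ, ℝ)) (r : ℝ) :
    IsClosed (c0Embedding e '' c0Box r) := by
  have hanti : AntilipschitzWith ‖(e : Y →L[ℝ] C₀(ℕ, ℝ))‖₊ (c0Embedding e) := by
    have h := e.symm.antilipschitz
    exact fun x y => h x y
  exact (hanti.isClosedEmbedding (c0Embedding e).uniformContinuous).isClosedMap _
    (isClosed_c0Box r)

lemma isBounded_c0Embedding_image (e : Y ≃L[ℝ] C₀(ℕ, ℝ)) {r : ℝ} (hr : 0 ≤ r) :
    Bornology.IsBounded (c0Embedding e '' c0Box r) :=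
  (c0Embedding e).lipschitz.isBounded_image <|
    (Metric.isBounded_closedBall (x := 0) (r := r)).subset fun _ hx => by
      simpa using norm_le_of_mem_c0Box hr hx

lemma c0Embedding_image_mem (e : Y ≃L[ℝ] C₀(ℕ, ℝ)) {r : ℝ} (hr : 0 ≤ r) {C : Set X}
    (hC : c0Embedding e '' c0Box r ⊆ C) :
    c0Embedding e '' c0Box r ∈ boundedClosedConvexSubsets C :=
  ⟨hC, ⟨_, mem_image_of_mem _ (zero_mem_c0Box hr)⟩, isBounded_c0Embedding_image e hr,
    isClosed_c0Embedding_image e r, (convex_c0Box r).is_linear_image (c0Embedding e).isLinear⟩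

lemma exists_pos_c0Embedding_image_subset (e : Y ≃L[ℝ] C₀(ℕ, ℝ)) {R : ℝ} (hR : 0 < R) :
    ∃ r > 0, c0Embedding e '' c0Box r ⊆ Metric.closedBall 0 R := by
  refine ⟨R / (‖c0Embedding e‖ + 1), by positivity, ?_⟩
  rintro _ ⟨x, hx, rfl⟩
  rw [mem_closedBall_zero_iff]
  calc ‖c0Embedding e x‖ ≤ ‖c0Embedding e‖ * (R / (‖c0Embedding e‖ + 1)) :=
        (c0Embedding e).le_opNorm_of_le (norm_le_of_mem_c0Box (by positivity) hx)
    _ ≤ R := by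
        rw [mul_div_assoc', div_le_iff₀ (by positivity), mul_comm]; gcongr; linarith

lemma exists_uniformlyHolderContractive_image (e : Y ≃L[ℝ] C₀(ℕ, ℝ)) {r : ℝ} (hr : 0 < r)
    {α lam η : ℝ} (hα : α ∈ Ioo (0 : ℝ) 1) (hlam : 0 < lam) (hη : 0 < η) :
    ∃ T : c0Embedding e '' c0Box r → c0Embedding e '' c0Box r,
      Function.fixedPoints T = ∅ ∧ UniformlyHolderContractive α lam T ∧
      (∀ ε > 0, ∃ x : c0Embedding e '' c0Box r, ‖(x : X) - T x‖ < ε) ∧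
      ∀ x, ‖(T x : X)‖ ≤ η := by
  have hY : c0Embedding e '' c0Box r ⊆ Y := by
    rintro _ ⟨x, -, rfl⟩; exact c0Embedding_mem e x
  have hlip : LipschitzWith ‖(e : Y →L[ℝ] C₀(ℕ, ℝ))‖₊
      (fun x : c0Embedding e '' c0Box r => e ⟨x, hY x.2⟩) :=
    fun x y => (e : Y →L[ℝ] C₀(ℕ, ℝ)).lipschitz ⟨x, hY x.2⟩ ⟨y, hY y.2⟩
  exact exists_uniformlyHolderContractive (c0Embedding e) hlip
    (fun x h => c0Embedding_symm e x (hY h)) hr (fun _ => mem_image_of_mem _) hα hlam hη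

lemma exists_uniformlyHolderContractive_closedBall (e : Y ≃L[ℝ] C₀(ℕ, ℝ)) (hY : Y.ClosedComplemented)
    {α lam : ℝ} (hα : α ∈ Ioo (0 : ℝ) 1) (hlam : 0 < lam) :
    ∃ T : Metric.closedBall (0 : X) 1 → Metric.closedBall (0 : X) 1,
      Function.fixedPoints T = ∅ ∧ UniformlyHolderContractive α lam T ∧
      minimalDisplacement T = 0 := by
  obtain ⟨P, hP⟩ := hY
  obtain ⟨r, hr, hball⟩ := exists_pos_c0Embedding_image_subset e one_pos
  set Q : X →L[ℝ] C₀(ℕ, ℝ) := (e : Y →L[ℝ] C₀(ℕ, ℝ)) ∘L P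
  have hlip : LipschitzWith ‖Q‖₊ (fun x : Metric.closedBall (0 : X) 1 => Q x) :=
    fun x y => Q.lipschitz x y
  have hQ (x : C₀(ℕ, ℝ)) : Q (c0Embedding e x) = x := by
    change e (P (e.symm x : X)) = x
    rw [hP, e.apply_symm_apply]
  obtain ⟨T, h1, h2, h3, -⟩ := exists_uniformlyHolderContractive (c0Embedding e) hlip
    (fun x _ => hQ x) hr (fun x hx => hball (mem_image_of_mem _ hx)) hα hlam one_pos
  exact ⟨T, h1, h2, minimalDisplacement_eq_zero h3⟩

/-- If `X` contains a copy of `c₀`, some bounded closed convex `K` in its unit ball carries fixed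
point free Hölder nonexpansive maps with approximate fixed points, converging to `x ↦ x / 2`. -/
lemma exists_holderNonexpansive_family (e : Y ≃L[ℝ] C₀(ℕ, ℝ)) :
    ∃ K ∈ boundedClosedConvexSubsets (Metric.closedBall (0 : X) 1),
      ∃ (T : ℝ → K → K) (S : K → K),
        (∀ α ∈ Ioo (0 : ℝ) 1, HolderNonexpansive α (T α) ∧
          Function.fixedPoints (T α) = ∅ ∧ minimalDisplacement (T α) = 0) ∧
        (∀ x : K, Tendsto (fun α : ℝ => (T α x : X)) (𝓝[<] 1) (𝓝 (S x : X))) ∧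
        (∀ x : K, (S x : X) = (1 / 2 : ℝ) • (x : X)) ∧
        (Function.fixedPoints S).ncard = 1 := by
  -- Radius `1 / 2` makes the diameter of `K` at most `1`, so that `dist x y ≤ dist x y ^ α`; the
  -- identity is then `α`-Hölder nonexpansive.
  obtain ⟨r, hr, hball⟩ := exists_pos_c0Embedding_image_subset e (R := 1 / 2) (by norm_num)
  set K := c0Embedding e '' c0Box r with hKdef
  have hK : K ∈ boundedClosedConvexSubsets (Metric.closedBall (0 : X) 1) :=
    c0Embedding_image_mem e hr.le
      (hball.trans (Metric.closedBall_subset_closedBall (by norm_num)))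
  have hconv : Convex ℝ K := hK.2.2.2.2
  have h0 : (0 : X) ∈ K := ⟨0, zero_mem_c0Box hr.le, map_zero _⟩
  have hdiam (x y : K) : dist x y ≤ 1 := by
    have hx := mem_closedBall_zero_iff.1 (hball x.2)
    have hy := mem_closedBall_zero_iff.1 (hball y.2)
    rw [Subtype.dist_eq, dist_eq_norm]
    linarith [norm_sub_le (x : X) y]
  have hex (α : ℝ) : ∃ G : K → K, α ∈ Ioo (0 : ℝ) 1 → Function.fixedPoints G = ∅ ∧
      UniformlyHolderContractive α 1 G ∧ (∀ ε > 0, ∃ x : K, ‖(x : X) - G x‖ < ε) ∧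
      ∀ x, ‖(G x : X)‖ ≤ 1 - α := by
    by_cases hα : α ∈ Ioo (0 : ℝ) 1
    · obtain ⟨G, hG⟩ := exists_uniformlyHolderContractive_image e hr hα one_pos
        (sub_pos.2 hα.2)
      exact ⟨G, fun _ => hG⟩
    -- Junk value outside `(0, 1)`.
    · exact ⟨id, fun h => absurd h hα⟩
  choose G hG using hex
  let mid (x y : K) : K := ⟨(1 / 2 : ℝ) • (x : X) + (1 / 2 : ℝ) • (y : X),
    hconv x.2 y.2 (by norm_num) (by norm_num) (by norm_num)⟩
  have hmid (x y : K) : (mid x y : X) = (1 / 2 : ℝ) • (x : X) + (1 / 2 : ℝ) • (y : X) := rfl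
  have hsub (x y : K) : (x : X) - mid x y = (1 / 2 : ℝ) • ((x : X) - y) := by
    rw [hmid]; module
  have hfix {x y : K} (h : mid x y = x) : y = x := by
    have h' := hsub x y
    rw [h, sub_self, eq_comm, smul_eq_zero, sub_eq_zero] at h'
    exact (Subtype.ext (h'.resolve_left (by norm_num))).symm
  have hS (x : K) : (mid x ⟨0, h0⟩ : X) = (1 / 2 : ℝ) • (x : X) := by simp [hmid]
  -- The midpoint of `x` and `G α x` has the fixed points of `G α` and half its displacement. As `α
  -- → 1`, `G α x → 0`, so the limit is the midpoint of `x` and `0`.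
  refine ⟨K, hK, fun α x => mid x (G α x), fun x => mid x ⟨0, h0⟩, ?_, ?_, hS, ?_⟩
  · intro α hα
    obtain ⟨hGfix, hGlip, hGdisp, -⟩ := hG α hα
    refine ⟨fun x y => ?_, eq_empty_of_forall_notMem fun x hx => ?_,
      minimalDisplacement_eq_zero fun ε hε => ?_⟩
    · have h1 : dist (G α x) (G α y) ≤ dist x y ^ α := by simpa using hGlip 1 le_rfl x y
      have h2 : dist x y ≤ dist x y ^ α :=
        Real.self_le_rpow_of_le_one dist_nonneg (hdiam x y) hα.2.le
      calc dist (mid x (G α x)) (mid y (G α y))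
          ≤ dist ((1 / 2 : ℝ) • (x : X)) ((1 / 2 : ℝ) • (y : X)) +
            dist ((1 / 2 : ℝ) • (G α x : X)) ((1 / 2 : ℝ) • (G α y : X)) :=
            dist_add_add_le _ _ _ _
        _ = 1 / 2 * dist x y + 1 / 2 * dist (G α x) (G α y) := by
            rw [dist_smul₀, dist_smul₀]; norm_num [Subtype.dist_eq]
        _ ≤ dist x y ^ α := by linarith
    · have : x ∈ Function.fixedPoints (G α) := hfix hx
      simp [hGfix] at this
    · obtain ⟨x, hx⟩ := hGdisp ε hε
      refine ⟨x, ?_⟩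
      rw [hsub, norm_smul]
      norm_num
      linarith [norm_nonneg ((x : X) - G α x)]
  · intro x
    have hzero : Tendsto (fun α => (G α x : X)) (𝓝[<] 1) (𝓝 0) := by
      have hlim : Tendsto (fun α : ℝ => 1 - α) (𝓝[<] 1) (𝓝 0) :=
        ((continuous_sub_left (1 : ℝ)).tendsto' 1 0 (sub_self 1)).mono_left nhdsWithin_le_nhds
      refine squeeze_zero_norm' ?_ hlim
      filter_upwards [Ioo_mem_nhdsLT (zero_lt_one' ℝ)] with α hα
      exact (hG α hα).2.2.2 x
    exact (hzero.const_smul (1 / 2 : ℝ)).const_add _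
  · rw [ncard_eq_one]
    refine ⟨⟨0, h0⟩, eq_singleton_iff_unique_mem.2 ⟨Subtype.ext (by simp [hS]), fun x hx => ?_⟩⟩
    exact (hfix hx).symm

end Embedding

theorem theorem5p1 (X : Type*) [NormedAddCommGroup X] [NormedSpace ℝ X] [CompleteSpace X]
    (hX : ContainsCopyOfC0 X) :
    (∃ K ∈ boundedClosedConvexSubsets (Metric.closedBall (0 : X) 1),
      ∃ (T : ℝ → K → K) (S : K → K),
        (∀ α ∈ Ioo (0 : ℝ) 1,
          HolderNonexpansive α (T α) ∧
          Function.fixedPoints (T α) = ∅ ∧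
          minimalDisplacement (T α) ≤
            (1 - α) * ⨆ t : Ioo (0 : ℝ) 1, (t : ℝ) ^ α * |Real.log (t : ℝ)|) ∧
        (∀ x : K, Tendsto (fun α : ℝ => (T α x : X)) (𝓝[<] 1) (𝓝 (S x : X))) ∧
        (∀ x y : K, dist (S x) (S y) ≤ dist x y) ∧
        (Function.fixedPoints S = ∅ ∨ (Function.fixedPoints S).ncard = 1)) ∧
    (∀ α ∈ Ioo (0 : ℝ) 1, ∀ lam ∈ Ioo (0 : ℝ) 1,
      ∃ K ∈ boundedClosedConvexSubsets (univ : Set X), ∃ F : K → K,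
        Function.fixedPoints F = ∅ ∧
        UniformlyHolderContractive α lam F ∧
        minimalDisplacement F = 0) ∧
    (SeparablySobczyk X →
      ∀ α ∈ Ioo (0 : ℝ) 1, ∀ lam ∈ Ioo (0 : ℝ) 1,
        ∃ T : Metric.closedBall (0 : X) 1 → Metric.closedBall (0 : X) 1,
          Function.fixedPoints T = ∅ ∧
          UniformlyHolderContractive α lam T ∧
          minimalDisplacement T = 0) := by

  obtain ⟨Y, ⟨e⟩⟩ := hX
  refine ⟨?_, fun α hα lam hlam => ?_, fun hS α hα lam hlam =>
    exists_uniformlyHolderContractive_closedBall e (hS Y ⟨e⟩) hα hlam.1⟩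
  · obtain ⟨K, hK, T, S, hT, hlim, hS, hfix⟩ := exists_holderNonexpansive_family e
    refine ⟨K, hK, T, S, fun α hα => ?_, hlim, fun x y => ?_, Or.inr hfix⟩
    · obtain ⟨h1, h2, h3⟩ := hT α hα
      refine ⟨h1, h2, h3.trans_le (mul_nonneg (sub_nonneg.2 hα.2.le) ?_)⟩
      exact Real.iSup_nonneg fun t => mul_nonneg (Real.rpow_nonneg t.2.1.le _) (abs_nonneg _)
    · rw [Subtype.dist_eq, hS, hS, dist_smul₀, ← Subtype.dist_eq]
      norm_num
      linarith [dist_nonneg (x := x) (y := y)]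
  · obtain ⟨T, h1, h2, h3, -⟩ :=
      exists_uniformlyHolderContractive_image e one_pos hα hlam.1 one_pos
    exact ⟨_, c0Embedding_image_mem e zero_le_one (subset_univ _), T, h1, h2,
      minimalDisplacement_eq_zero h3⟩
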